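/- Let $X$ be a non-empty compact metrizable zero-dimensional space and let $T:X\to X$ be a homeomorphism. A point $x$ is periodic if $T^nx=x$ for some $n\ge 1$, and aperiodic otherwise. Then $(X,T)$ is Bratteli--Vershikizable if and only if either the set of aperiodic points is dense in $X$, or there is exactly one periodic orbit that is disjoint from the closure of the set of aperiodic points. Here the following terminology is used. A Bratteli diagram $B$ consists of finite vertex sets $V_0,V_1,V_2,\dots$ with $V_0=\{v_0\}$ a singleton, and finite edge sets $E_1,E_2,\dots$; each $e\in E_k$ has a source $s(e)\in V_k$ and a target $t(e)\in V_{k-1}$ (multiple edges are allowed), every vertex is the target of at least one edge, and every vertex of level $k>0$ is the source of at least one edge. Its path space $X_B$ is the set of infinite sequences $(e_1,e_2,\dots)$ with $e_k\in E_k$ and $t(e_{k+1})=s(e_k)$ for all $k\ge 1$, with the topology inherited from the product $\prod_k E_k$ of discrete spaces. An ordered Bratteli diagram is a Bratteli diagram with a partial order on edges such that, for every vertex $v$ of level $k>0$, the edges with source $v$ are linearly ordered, and edges with different sources are incomparable. A path $(e_j)$ precedes a path $(e'_j)$ in $X_B$ if for some $i$ one has $e_j=e'_j$ for all $j>i$ and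 $e_i<e'_i$. A path is maximal if it has no (immediate) successor for this order; the Vershik map is defined on the set of all non-maximal paths and sends each of them to its successor. The ordered diagram is decisive if there is exactly one homeomorphism $\overline T_V$ of $X_B$ that prolongs the Vershik map. The system $(X,T)$ is Bratteli--Vershikizable if it is topologically conjugate to $(X_B,\overline T_V)$ for some decisive ordered Bratteli diagram. -/

import Mathlib

/-- A Bratteli diagram. `V k` is the `k`-th level of vertices and `E k` is the set of edges between
levels `k + 1` and `k` (often written `E_{k+1}`). An edge of `E k` runs from its source in
`V (k + 1)` to its target in `V k`; multiple edges are allowed. -/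
structure BratteliDiagram where
  V : ℕ → Type
  E : ℕ → Type
  finite_V : ∀ k, Finite (V k)
  finite_E : ∀ k, Finite (E k)
  /-- level zero is a single vertex `v₀` -/
  root : Nonempty (V 0) ∧ Subsingleton (V 0)
  source : ∀ k, E k → V (k + 1)
  target : ∀ k, E k → V k
  /-- every vertex is the target of some edge -/
  target_surjective : ∀ k, Function.Surjective (target k)
  /-- every vertex of positive level is the source of some edge -/
  source_surjective : ∀ k, Function.Surjective (source k)

namespace BratteliDiagram

/-- The path space `X_B`: infinite paths `(p 0, p 1, …)` of edges with target `v₀`. (The target of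
`p 0` lies in `V 0 = {v₀}`, so it is `v₀` automatically.) -/
def PathSpace (B : BratteliDiagram) : Type :=
  {p : ∀ k, B.E k // ∀ k, B.target (k + 1) (p (k + 1)) = B.source k (p k)}

/-- The topology on `X_B` inherited from the product of the discrete edge sets. -/
instance (B : BratteliDiagram) : TopologicalSpace B.PathSpace :=
  TopologicalSpace.induced (fun p : B.PathSpace => p.1)
    (@Pi.topologicalSpace ℕ B.E (fun _ => ⊥))

end BratteliDiagram

/-- An ordered Bratteli diagram: a partial order on the edges for which two edges are comparable
if and only if they have the same source. -/
structure OrderedBratteliDiagram extends BratteliDiagram where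
  edgeOrder : ∀ k, PartialOrder (E k)
  comparable_iff : ∀ k (e e' : E k), (e ≤ e' ∨ e' ≤ e) ↔ source k e = source k e'

namespace OrderedBratteliDiagram

instance (B : OrderedBratteliDiagram) (k : ℕ) : PartialOrder (B.E k) := B.edgeOrder k

variable (B : OrderedBratteliDiagram)

/-- The inverse lexicographical order on infinite paths: `p` precedes `q` if for some `i` the two
paths agree at all places `j > i` and `p i < q i`. In particular comparable paths are cofinal. -/
def Precedes (p q : B.PathSpace) : Prop :=
  ∃ i, (∀ j, i < j → p.1 j = q.1 j) ∧ p.1 i < q.1 i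

/-- `q` is the (immediate) successor of `p`. -/
def IsSuccessor (p q : B.PathSpace) : Prop :=
  B.Precedes p q ∧ ∀ r, ¬ (B.Precedes p r ∧ B.Precedes r q)

/-- A path is maximal if it has no successor. -/
def IsMaximal (p : B.PathSpace) : Prop := ¬ ∃ q, B.IsSuccessor p q

/-- The Vershik map: defined on the set of all non-maximal paths, it sends each of them to its
successor (which is unique, see `IsSuccessor.unique`). -/
noncomputable def vershikMap (p : {p : B.PathSpace // ¬ B.IsMaximal p}) : B.PathSpace :=
  (not_not.mp p.2).choose

/-- The homeomorphism `S` of the path space prolongs the Vershik map. -/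
def Prolongs (S : B.PathSpace ≃ₜ B.PathSpace) : Prop :=
  ∀ p : {p : B.PathSpace // ¬ B.IsMaximal p}, S p.1 = B.vershikMap p

/-- The ordered diagram is decisive: its Vershik map prolongs in a unique way to a homeomorphism of
the whole path space. -/
def IsDecisive : Prop := ∃! S : B.PathSpace ≃ₜ B.PathSpace, B.Prolongs S

variable {B}

theorem precedes_trichotomy_of_cofinal {q r : B.PathSpace} (n : ℕ)
    (h : ∀ j, n ≤ j → q.1 j = r.1 j) : B.Precedes q r ∨ q = r ∨ B.Precedes r q := by
  induction n with
  | zero => exact Or.inr (Or.inl (Subtype.ext (funext fun j => h j (Nat.zero_le j))))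
  | succ n ih =>
    by_cases hn : q.1 n = r.1 n
    · refine ih fun j hj => ?_
      rcases hj.eq_or_lt with rfl | hj
      · exact hn
      · exact h j hj
    · have hs : B.source n (q.1 n) = B.source n (r.1 n) := by
        rw [← q.2 n, ← r.2 n, h (n + 1) le_rfl]
      rcases (B.comparable_iff n _ _).mpr hs with hle | hle
      · exact Or.inl ⟨n, fun j hj => h j hj, lt_of_le_of_ne hle hn⟩
      · exact Or.inr (Or.inr ⟨n, fun j hj => (h j hj).symm, lt_of_le_of_ne hle (Ne.symm hn)⟩)

/-- A path has at most one successor. -/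
theorem IsSuccessor.unique {p q r : B.PathSpace} (hq : B.IsSuccessor p q)
    (hr : B.IsSuccessor p r) : q = r := by
  obtain ⟨i, hi, -⟩ := hq.1
  obtain ⟨i', hi', -⟩ := hr.1
  rcases precedes_trichotomy_of_cofinal (q := q) (r := r) (max i i' + 1)
    (fun j hj => by rw [← hi j (by omega), ← hi' j (by omega)]) with h | h | h
  · exact absurd ⟨hq.1, h⟩ (hr.2 q)
  · exact h
  · exact absurd ⟨hr.1, h⟩ (hq.2 r)

theorem vershikMap_eq_iff (p : {p : B.PathSpace // ¬ B.IsMaximal p}) (q : B.PathSpace) :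
    B.vershikMap p = q ↔ B.IsSuccessor p.1 q := by
  have hs : B.IsSuccessor p.1 (B.vershikMap p) := (not_not.mp p.2).choose_spec
  exact ⟨fun h => h ▸ hs, fun h => hs.unique h⟩

end OrderedBratteliDiagram

/-- The systems `(X, T)` and `(Y, S)` are topologically conjugate. -/
def AreConjugate {X Y : Type*} [TopologicalSpace X] [TopologicalSpace Y]
    (T : X ≃ₜ X) (S : Y ≃ₜ Y) : Prop :=
  ∃ h : X ≃ₜ Y, ∀ x, h (T x) = S (h x)

/-- `(X, T)` is conjugate to `(X_B, S)` where `S` is the unique homeomorphic prolongation of the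
Vershik map of some decisive ordered Bratteli diagram `B`. -/
def BratteliVershikizable {X : Type*} [TopologicalSpace X] (T : X ≃ₜ X) : Prop :=
  ∃ B : OrderedBratteliDiagram, B.IsDecisive ∧
    ∃ S : B.PathSpace ≃ₜ B.PathSpace, B.Prolongs S ∧ AreConjugate T S

/-- The set of aperiodic points: those `x` with `T^n x ≠ x` for all `n ≥ 1`. -/
def aperiodicPts {X : Type*} (T : X → X) : Set X := (Function.periodicPts T)ᶜ

/-- `O` is the orbit of some periodic point. -/
def IsPeriodicOrbit {X : Type*} (T : X → X) (O : Set X) : Prop :=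
  ∃ x ∈ Function.periodicPts T, O = Set.range fun n : ℕ => T^[n] x

/-!
The Vershik map prescribes the values of a prolongation `S` exactly off the set `M` of maximal
paths, which is closed. By continuity, `S` is thus free at most in the interior of `M`.

*Necessity.* If the diagram is decisive, composing `S` with a homeomorphism supported in the interior
of `M` changes nothing, so there is no such homeomorphism but the identity. In a zero-dimensional
compact metrizable space this forces the interior of `M` to have at most one point
(`IsOpen.subsingleton_of_forall_homeomorph_eq_refl`): two isolated points could be exchanged, and a
clopen set without isolated points is a Cantor space by Brouwer's theorem
(`nonempty_homeomorph_nat_bool`), hence not rigid. On the other hand the Vershik map increases in the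
order on paths, so each periodic orbit contains a maximal path. In the open set `U` of points away
from the closure of the aperiodic points, every nonempty open subset is covered by the countably many
closed sets `S⁻ⁿ M`, hence by Baire's theorem contains a point whose orbit meets the interior of `M`.
As that interior has at most one point, `U` is empty or a single periodic orbit
(`dense_aperiodicPts_or_existsUnique`).

*Sufficiency.* Let `B₀ = X ⊇ B₁ ⊇ …` be clopen sets, each of them met by all orbits, and let `F` be
their intersection. Cutting the `Bₖ` into finer and finer pieces gives a nested sequence of
Kakutani–Rokhlin partitions (`exists_towerSystem`), and its ordered Bratteli diagram has path space
`X`, maximal paths `T⁻¹ F`, and Vershik map `T` (`TowerSystem.diagram`, `TowerSystem.prolongs_iff`).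
If `F` has at most one interior point, the diagram is decisive, because two homeomorphisms cannot
differ at a single point (`TowerSystem.bratteliVershikizable`). It remains to find such `Bₖ`. Any
aperiodic point `x` of a clopen set `B` met by all orbits has a clopen neighbourhood `C` that can be
removed from `B`: the orbit of `x` returns to `B` at another point `Tᵏ x`, and if `C` is small, a point
of `C` is moved by `Tᵏ` into `B \ C` (`exists_isClopen_subset_not_superset`). Doing this along a
countable basis yields an `F` whose interior contains no aperiodic point. If the aperiodic points are
dense, the interior is empty; otherwise `U` is a finite open orbit, and starting from the complement
of all but one of its points leaves at most this point
(`exists_antitone_base_subsingleton`).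
-/

section

open Set Topology TopologicalSpace

/-! ### The Cantor space -/

theorem IsClopen.eventually_mem_iff {X : Type*} [TopologicalSpace X] {s : Set X} (hs : IsClopen s)
    (x : X) : ∀ᶠ y in 𝓝 x, (y ∈ s ↔ x ∈ s) := by
  by_cases hx : x ∈ s
  · filter_upwards [hs.isOpen.mem_nhds hx] with y hy using iff_of_true hy hx
  · filter_upwards [hs.compl.isOpen.mem_nhds hx] with y hy using iff_of_false hy hx

section CantorSpace

variable {K : Type*} [TopologicalSpace K]

/-- In a space without isolated points, a nonempty clopen set `S` can be cut by a clopen set `D` into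
two nonempty pieces, neither of which is cut by the given clopen set `A`. -/
theorem TopologicalSpace.Clopens.exists_split [TotallySeparatedSpace K]
    (hK : ∀ x : K, ¬ IsOpen ({x} : Set K)) (S A : Clopens K) (hS : (S : Set K).Nonempty) :
    ∃ D : Clopens K, ((S : Set K) ∩ D).Nonempty ∧ ((S : Set K) \ D).Nonempty ∧
      ∀ x ∈ S, ∀ y ∈ S, (x ∈ D ↔ y ∈ D) → (x ∈ A ↔ y ∈ A) := by
  by_cases h : ((S : Set K) ∩ A).Nonempty ∧ ((S : Set K) \ A).Nonempty
  · exact ⟨A, h.1, h.2, fun _ _ _ _ => id⟩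
  -- otherwise `A` does not cut `S` at all, and any nontrivial cut will do
  · obtain ⟨x, hx⟩ := hS
    have hne : ∃ y ∈ S, y ≠ x := by
      by_contra! hy
      refine hK x ?_
      convert S.isClopen.isOpen using 1
      ext z
      exact ⟨fun hz => hz ▸ hx, fun hz => hy z hz⟩
    obtain ⟨y, hy, hyx⟩ := hne
    obtain ⟨D, hD, hyD, hxD⟩ := exists_isClopen_of_totally_separated hyx
    refine ⟨⟨D, hD⟩, ⟨y, hy, hyD⟩, ⟨x, hx, hxD⟩, fun a ha b hb _ => ?_⟩
    by_contra hab
    apply h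
    by_cases haA : a ∈ A
    · exact ⟨⟨a, ha, haA⟩, ⟨b, hb, fun hbA => hab ⟨fun _ => hbA, fun _ => haA⟩⟩⟩
    · refine ⟨⟨b, hb, ?_⟩, ⟨a, ha, haA⟩⟩
      by_contra hbA
      exact hab ⟨fun h => absurd h haA, fun h => absurd h hbA⟩

/-- The binary scheme of clopen sets obtained by cutting the set attached to a word of length `n`
with `D · n`; the last letter of the word stands at the head of the list. -/
noncomputable def clopenScheme (D : Clopens K → ℕ → Clopens K) : List Bool → Clopens K
  | [] => ⊤
  | b :: s =>
    let S := clopenScheme D s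
    if b then S ⊓ D S s.length else S \ D S s.length

open Classical in
/-- The word of length `n` whose set in `clopenScheme D` contains `x`. -/
noncomputable def clopenItinerary (D : Clopens K → ℕ → Clopens K) (x : K) : ℕ → List Bool
  | 0 => []
  | n + 1 => decide (x ∈ D (clopenScheme D (clopenItinerary D x n)) n) :: clopenItinerary D x n

/-- The initial words of a binary sequence, with the last letter at the head. -/
def initialWord (a : ℕ → Bool) : ℕ → List Bool
  | 0 => []
  | n + 1 => a n :: initialWord a n

theorem length_initialWord (a : ℕ → Bool) (n : ℕ) : (initialWord a n).length = n := by
  induction n with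
  | zero => rfl
  | succ n ih => simp [initialWord, ih]

open Classical in
/-- **Brouwer's theorem**: a nonempty compact metrizable totally disconnected space without isolated
points is homeomorphic to the Cantor space. -/
theorem nonempty_homeomorph_nat_bool [CompactSpace K] [MetrizableSpace K]
    [TotallyDisconnectedSpace K] [Nonempty K] (hK : ∀ x : K, ¬ IsOpen ({x} : Set K)) :
    Nonempty (K ≃ₜ (ℕ → Bool)) := by
  let := metrizableSpaceMetric K
  have : SecondCountableTopology K := inferInstance
  have : Countable (Clopens K) := Clopens.countable_iff_secondCountable.mpr inferInstance
  obtain ⟨A, hA⟩ := exists_surjective_nat (Clopens K)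
  have hD : ∀ (S : Clopens K) (n : ℕ), ∃ D : Clopens K, (S : Set K).Nonempty →
      ((S : Set K) ∩ D).Nonempty ∧ ((S : Set K) \ D).Nonempty ∧
      ∀ x ∈ S, ∀ y ∈ S, (x ∈ D ↔ y ∈ D) → (x ∈ A n ↔ y ∈ A n) := by
    intro S n
    by_cases hS : (S : Set K).Nonempty
    · obtain ⟨D, hD⟩ := S.exists_split hK (A n) hS
      exact ⟨D, fun _ => hD⟩
    · exact ⟨⊤, fun h => absurd h hS⟩
  choose D hD using hD
  have hne : ∀ s, (clopenScheme D s : Set K).Nonempty := by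
    intro s
    induction s with
    | nil => exact univ_nonempty
    | cons b s ih =>
      cases b
      · simpa [clopenScheme] using (hD _ s.length ih).2.1
      · simpa [clopenScheme] using (hD _ s.length ih).1
  let f : K → ℕ → Bool := fun x n => decide (x ∈ D (clopenScheme D (clopenItinerary D x n)) n)
  have hw : ∀ x n, clopenItinerary D x n = initialWord (f x) n := by
    intro x n
    induction n with
    | zero => rfl
    | succ n ih => rw [clopenItinerary, initialWord, ih]; simp only [f, ih]
  have hf : ∀ x n, f x n = true ↔ x ∈ D (clopenScheme D (initialWord (f x) n)) n := by
    intro x n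
    rw [← hw]
    exact decide_eq_true_iff
  have hmem : ∀ x n, x ∈ clopenScheme D (initialWord (f x) n) := by
    intro x n
    induction n with
    | zero => trivial
    | succ n ih =>
      rw [initialWord, clopenScheme, length_initialWord]
      cases h : f x n
      · exact ⟨ih, fun hx => by simp [(hf x n).mpr hx] at h⟩
      · exact ⟨ih, (hf x n).mp h⟩
  have hcont : Continuous f := by
    have hit : ∀ n, IsLocallyConstant fun x => clopenItinerary D x n := by
      intro n
      induction n with
      | zero => exact IsLocallyConstant.const _
      | succ n ih =>
        rw [IsLocallyConstant.iff_eventually_eq] at ih ⊢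
        intro x
        filter_upwards [ih x, (D (clopenScheme D (clopenItinerary D x n))
          n).isClopen.eventually_mem_iff x] with y hy hy'
        rw [clopenItinerary, clopenItinerary, hy]
        congr 1
        exact decide_eq_decide.mpr hy'
    refine continuous_pi fun n => ?_
    exact ((hit (n + 1)).comp fun s => s.headD true).continuous
  have hinj : Function.Injective f := by
    intro x y hxy
    by_contra hne'
    obtain ⟨U, hU, hxU, hyU⟩ := exists_isClopen_of_totally_separated hne'
    obtain ⟨n, hn⟩ := hA ⟨U, hU⟩
    have hy := hmem y n
    rw [← hxy] at hy
    have h := (hD _ n (hne (initialWord (f x) n))).2.2 x (hmem x n) y hy (by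
      rw [← hf]
      nth_rw 1 [hxy]
      rw [hf, hxy])
    rw [hn] at h
    exact hyU (h.mp hxU)
  have hsurj : Function.Surjective f := by
    intro a
    obtain ⟨x, hx⟩ := IsCompact.nonempty_iInter_of_sequence_nonempty_isCompact_isClosed
      (fun n => (clopenScheme D (initialWord a n) : Set K))
      (fun n => by
        intro x hx
        simp only [initialWord, clopenScheme] at hx
        split_ifs at hx
        · exact hx.1
        · exact hx.1)
      (fun n => hne _) (Clopens.isClopen _).isClosed.isCompact
      (fun n => (Clopens.isClopen _).isClosed)
    rw [mem_iInter] at hx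
    refine ⟨x, ?_⟩
    have hstep : ∀ n, initialWord (f x) n = initialWord a n → f x n = a n := by
      intro n hn
      have h := hx (n + 1)
      simp only [initialWord, clopenScheme, length_initialWord] at h
      rw [Bool.eq_iff_iff, hf, hn]
      cases ha : a n
      · simp only [ha] at h
        exact iff_of_false h.2 (by simp)
      · simp only [ha] at h
        exact iff_of_true h.2 rfl
    have hword : ∀ n, initialWord (f x) n = initialWord a n := by
      intro n
      induction n with
      | zero => rfl
      | succ n ih => rw [initialWord, initialWord, ih, hstep n ih]
    exact funext fun n => hstep n (hword n)
  exact ⟨(hcont.isClosedEmbedding hinj).isEmbedding.toHomeomorphOfSurjective hsurj⟩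

end CantorSpace

/-! ### Homeomorphisms supported in an open set -/

section SupportedHomeomorphisms

variable {X : Type*} [TopologicalSpace X]

open Classical in
/-- A self-homeomorphism of a clopen set extends by the identity to the whole space. -/
theorem IsClopen.exists_homeomorph_extension {K : Set X} (hK : IsClopen K) (e : K ≃ₜ K) :
    ∃ φ : X ≃ₜ X, (∀ x ∉ K, φ x = x) ∧ ∀ x : K, φ x = e x := by
  have hcont : ∀ g : K ≃ₜ K, Continuous (Equiv.Perm.ofSubtype (p := (· ∈ K)) g.toEquiv) := by
    intro g
    rw [← continuousOn_univ, ← union_compl_self K]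
    refine ContinuousOn.union_of_isOpen ?_ ?_ hK.isOpen hK.compl.isOpen
    · rw [continuousOn_iff_continuous_domRestrict]
      refine (continuous_subtype_val.comp g.continuous).congr fun x => ?_
      exact (Equiv.Perm.ofSubtype_apply_coe _ x).symm
    · refine continuousOn_id.congr fun x hx => ?_
      exact Equiv.Perm.ofSubtype_apply_of_not_mem _ hx
  refine ⟨⟨Equiv.Perm.ofSubtype (p := (· ∈ K)) e.toEquiv, hcont e, ?_⟩,
    fun x hx => Equiv.Perm.ofSubtype_apply_of_not_mem _ hx,
    fun x => Equiv.Perm.ofSubtype_apply_coe _ x⟩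
  have := hcont e.symm
  have h2 : (Equiv.Perm.ofSubtype (p := (· ∈ K)) e.symm.toEquiv) =
    (Equiv.Perm.ofSubtype (p := (· ∈ K)) e.toEquiv).symm := by
    exact map_inv (Equiv.Perm.ofSubtype (p := (· ∈ K))) e.toEquiv
  rwa [h2] at this

/-- If the only homeomorphism supported in an open set `G` is the identity, then `G` has at most one
point: two isolated points could be exchanged, and a clopen set without isolated points is a Cantor
space, which has nontrivial self-homeomorphisms. -/
theorem IsOpen.subsingleton_of_forall_homeomorph_eq_refl [CompactSpace X] [MetrizableSpace X]
    [TotallyDisconnectedSpace X] {G : Set X} (hG : IsOpen G)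
    (h : ∀ φ : X ≃ₜ X, (∀ x ∉ G, φ x = x) → ∀ x, φ x = x) : G.Subsingleton := by
  have hrigid : ∀ K : Set X, IsClopen K → K ⊆ G → ∀ e : K ≃ₜ K, ∀ x, e x = x := by
    intro K hK hKG e x
    obtain ⟨φ, hφ, hφe⟩ := hK.exists_homeomorph_extension e
    exact Subtype.ext ((hφe x).symm.trans (h φ (fun y hy => hφ y fun hyK => hy (hKG hyK)) x))
  -- otherwise there would be an open set `W` in `G` without isolated points
  have hiso : ∀ W ⊆ G, IsOpen W → W.Nonempty → ∃ z ∈ W, IsOpen ({z} : Set X) := by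
    intro W hWG hW ⟨w, hw⟩
    by_contra! hno
    obtain ⟨K, hK, hwK, hKW⟩ := compact_exists_isClopen_in_isOpen hW hw
    have : CompactSpace K := isCompact_iff_compactSpace.mp hK.isClosed.isCompact
    have : Nonempty K := ⟨⟨w, hwK⟩⟩
    obtain ⟨e⟩ := nonempty_homeomorph_nat_bool (K := K) fun z hz => hno z (hKW z.2) (by
      have := hK.isOpen.isOpenMap_subtype_val _ hz
      rwa [image_singleton] at this)
    let flip : (ℕ → Bool) ≃ₜ (ℕ → Bool) := Homeomorph.piCongrRight fun _ =>
      ⟨Equiv.boolNot, continuous_of_discreteTopology, continuous_of_discreteTopology⟩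
    have h1 := hrigid K hK (hKW.trans hWG) ((e.trans flip).trans e.symm) (e.symm fun _ => true)
    have h2 := congrFun (congrArg e h1) 0
    simp [flip] at h2
  intro a ha b hb
  by_contra hab
  -- two disjoint open pieces of `G` contain two different isolated points
  obtain ⟨U, V, hU, hV, haU, hbV, hUV⟩ := t2_separation hab
  obtain ⟨x, ⟨hxG, hxU⟩, hx⟩ := hiso (G ∩ U) inter_subset_left (hG.inter hU) ⟨a, ha, haU⟩
  obtain ⟨y, ⟨hyG, hyV⟩, hy⟩ := hiso (G ∩ V) inter_subset_left (hG.inter hV) ⟨b, hb, hbV⟩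
  have hxy : x ≠ y := fun hxy => disjoint_left.mp hUV hxU (hxy ▸ hyV)
  have hK : IsClopen ({x, y} : Set X) := ⟨(toFinite _).isClosed, by
    rw [insert_eq]; exact hx.union hy⟩
  have : DiscreteTopology ({x, y} : Set X) := Finite.instDiscreteTopology
  classical
  let x' : ({x, y} : Set X) := ⟨x, by simp⟩
  let y' : ({x, y} : Set X) := ⟨y, by simp⟩
  have h1 := hrigid _ hK (by rintro z (rfl | rfl) <;> assumption)
    ⟨Equiv.swap x' y', continuous_of_discreteTopology, continuous_of_discreteTopology⟩ x'
  have h2 : y' = x' := (Equiv.swap_apply_left x' y').symm.trans h1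
  exact hxy (congrArg Subtype.val h2).symm

end SupportedHomeomorphisms

/-! ### Periodic orbits away from the closure of the aperiodic points -/

section NecessaryCondition

open Function

variable {X : Type*} [TopologicalSpace X]

theorem Homeomorph.pow_apply_eq_iterate {T : X ≃ₜ X} (n : ℕ) (x : X) : (T ^ n) x = T^[n] x := by
  induction n generalizing x with
  | zero => rfl
  | succ n ih => rw [Function.iterate_succ_apply, ← ih, pow_succ]; rfl

theorem apply_mem_closure_aperiodicPts {T : X ≃ₜ X} {x : X} :
    T x ∈ closure (aperiodicPts T) ↔ x ∈ closure (aperiodicPts T) := by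
  have himage : T ⁻¹' (aperiodicPts T) = aperiodicPts T := by
    ext y
    have : T y ∈ periodicPts T ↔ y ∈ periodicPts T := by
      simp only [mem_periodicPts, IsPeriodicPt, IsFixedPt, ← iterate_succ_apply,
        iterate_succ_apply', T.injective.eq_iff]
    exact not_congr this
  have := T.preimage_closure (aperiodicPts T)
  rw [himage] at this
  exact Set.ext_iff.mp this x

theorem iterate_mem_closure_aperiodicPts {T : X ≃ₜ X} {x : X} (n : ℕ) :
    T^[n] x ∈ closure (aperiodicPts T) ↔ x ∈ closure (aperiodicPts T) := by
  induction n with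
  | zero => rfl
  | succ n ih => rw [iterate_succ_apply', apply_mem_closure_aperiodicPts, ih]

/-- A point whose forward orbit hits a periodic point `g`, if it is periodic itself, lies in the
forward orbit of `g`. -/
theorem Function.exists_iterate_eq_of_mem_periodicPts {α : Type*} {f : α → α} {x g : α} {n : ℕ}
    (hx : x ∈ periodicPts f) (h : f^[n] x = g) : ∃ m, f^[m] g = x := by
  obtain ⟨p, hp, hpx⟩ := hx
  refine ⟨p * n - n, ?_⟩
  rw [← h, ← iterate_add_apply, Nat.sub_add_cancel (Nat.le_mul_of_pos_left n hp)]
  exact (hpx.mul_const n)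

theorem finite_range_iterate {α : Type*} {f : α → α} {g : α} (hg : g ∈ periodicPts f) :
    (range fun n : ℕ => f^[n] g).Finite := by
  obtain ⟨p, hp, hpg⟩ := hg
  refine ((finite_Iio p).image fun n => f^[n] g).subset ?_
  rintro _ ⟨n, rfl⟩
  exact ⟨n % p, Nat.mod_lt n hp, hpg.iterate_mod_apply n⟩

/-- Let every periodic orbit meet the closed set `M`, and let `T` be determined by its values
outside `M`. Then the aperiodic points are dense or exactly one periodic orbit avoids their closure.
-/
theorem dense_aperiodicPts_or_existsUnique [CompactSpace X] [MetrizableSpace X]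
    [TotallyDisconnectedSpace X] (T : X ≃ₜ X) {M : Set X} (hM : IsClosed M)
    (hdet : ∀ T' : X ≃ₜ X, (∀ x ∉ M, T' x = T x) → T' = T)
    (hper : ∀ x ∈ periodicPts T, ∃ n, T^[n] x ∈ M) :
    Dense (aperiodicPts T) ∨
      ∃! O : Set X, IsPeriodicOrbit T O ∧ Disjoint O (closure (aperiodicPts T)) := by
  have hsub : (interior M).Subsingleton := by
    refine isOpen_interior.subsingleton_of_forall_homeomorph_eq_refl fun φ hφ x => ?_
    have := hdet (φ.trans T) fun y hy => by
      rw [Homeomorph.trans_apply, hφ y fun hy' => hy (interior_subset hy')]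
    exact T.injective (congrArg (fun S : X ≃ₜ X => S x) this)
  refine or_iff_not_imp_left.mpr fun hdense => ?_
  set U : Set X := (closure (aperiodicPts T))ᶜ with hUdef
  have hU : IsOpen U := isClosed_closure.isOpen_compl
  have hUper : ∀ x ∈ U, x ∈ periodicPts T := fun x hx =>
    not_not.mp fun hx' => hx (subset_closure hx')
  have hUT : ∀ n x, T^[n] x ∈ U ↔ x ∈ U := fun n x => not_congr (iterate_mem_closure_aperiodicPts n)
  obtain ⟨x₀, hx₀⟩ : U.Nonempty := by
    rw [nonempty_iff_ne_empty, hUdef, Ne, compl_empty_iff, ← dense_iff_closure_eq]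
    exact hdense
  have hcontT : ∀ n, Continuous T^[n] := fun n => T.continuous.iterate n
  -- by Baire's theorem, each nonempty open `W ⊆ U` contains a point whose orbit meets `interior M`
  have hbaire : ∀ W ⊆ U, IsOpen W → W.Nonempty → ∃ x ∈ W, ∃ n, T^[n] x ∈ interior M := by
    intro W hWU hW hWne
    have hd : Dense (⋃ o : Option ℕ, interior (o.elim Wᶜ fun n => T^[n] ⁻¹' M)) := by
      refine dense_iUnion_interior_of_closed ?_ ?_
      · rintro (_ | n)
        · exact hW.isClosed_compl
        · exact hM.preimage (hcontT n)
      · refine eq_univ_of_forall fun x => mem_iUnion.mpr ?_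
        by_cases hx : x ∈ W
        · obtain ⟨n, hn⟩ := hper x (hUper x (hWU hx))
          exact ⟨some n, hn⟩
        · exact ⟨none, hx⟩
    obtain ⟨x, hxW, hx⟩ := hd.inter_open_nonempty W hW hWne
    obtain ⟨_ | n, hn⟩ := mem_iUnion.mp hx
    · exact absurd hxW (interior_subset hn)
    · refine ⟨x, hxW, n, ?_⟩
      have hpre : T^[n] ⁻¹' interior M = interior (T^[n] ⁻¹' M) := by
        rw [← show ⇑(T ^ n) = T^[n] from funext (Homeomorph.pow_apply_eq_iterate n)]
        exact (T ^ n).preimage_interior M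
      exact hpre.symm.subset hn
  obtain ⟨y₀, hy₀U, n₀, hg⟩ := hbaire U Subset.rfl hU ⟨x₀, hx₀⟩
  set g := T^[n₀] y₀
  have hgU : g ∈ U := (hUT n₀ y₀).mpr hy₀U
  set O : Set X := range fun n : ℕ => T^[n] g
  have hOU : O ⊆ U := by
    rintro _ ⟨n, rfl⟩
    exact (hUT n g).mpr hgU
  have hUO : U ⊆ O := by
    by_contra hnot
    obtain ⟨z, hzU, hzO⟩ := not_subset.mp hnot
    obtain ⟨x, ⟨hxU, hxO⟩, n, hn⟩ := hbaire (U \ O) sdiff_subset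
      (hU.sdiff (finite_range_iterate (hUper g hgU)).isClosed) ⟨z, hzU, hzO⟩
    exact hxO (exists_iterate_eq_of_mem_periodicPts (hUper x hxU) (hsub hn hg))
  refine ⟨O, ⟨⟨g, hUper g hgU, rfl⟩, disjoint_left.mpr hOU⟩, ?_⟩
  rintro _ ⟨⟨x, hx, rfl⟩, hdisj⟩
  have hxU : x ∈ U := disjoint_left.mp hdisj ⟨0, rfl⟩
  obtain ⟨m, hm⟩ := hUO hxU
  obtain ⟨l, hl⟩ := exists_iterate_eq_of_mem_periodicPts (hUper g hgU) hm
  apply Subset.antisymm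
  · rintro _ ⟨n, rfl⟩
    exact ⟨n + m, by simp only [iterate_add_apply]; rw [← hm]⟩
  · rintro _ ⟨n, rfl⟩
    exact ⟨n + l, by simp only [iterate_add_apply]; rw [← hl]⟩

end NecessaryCondition

/-! ### Maximal paths of an ordered Bratteli diagram -/

namespace OrderedBratteliDiagram

variable {B : OrderedBratteliDiagram}

theorem Precedes.irrefl (p : B.PathSpace) : ¬ B.Precedes p p := fun ⟨_, _, h⟩ => lt_irrefl _ h

theorem Precedes.trans {p q r : B.PathSpace} (hpq : B.Precedes p q) (hqr : B.Precedes q r) :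
    B.Precedes p r := by
  obtain ⟨i, hi, hilt⟩ := hpq
  obtain ⟨j, hj, hjlt⟩ := hqr
  rcases lt_trichotomy i j with h | rfl | h
  · exact ⟨j, fun k hk => (hi k (h.trans hk)).trans (hj k hk), by rwa [hi j h]⟩
  · exact ⟨i, fun k hk => (hi k hk).trans (hj k hk), hilt.trans hjlt⟩
  · exact ⟨i, fun k hk => (hi k hk).trans (hj k (h.trans hk)), by rwa [← hj i h]⟩

/-- If `p ≺ s ≺ r` and `p`, `r` agree beyond `i`, then so do `p` and `s`. -/
theorem Precedes.eq_of_between {p s r : B.PathSpace} {i : ℕ} (hps : B.Precedes p s)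
    (hsr : B.Precedes s r) (h : ∀ j, i < j → r.1 j = p.1 j) : ∀ j, i < j → s.1 j = p.1 j := by
  obtain ⟨a, ha, halt⟩ := hps
  obtain ⟨b, hb, hblt⟩ := hsr
  have ha' : a ≤ i := by
    by_contra! hia
    rw [← h a hia] at halt
    rcases lt_trichotomy a b with hab | rfl | hab
    · have := hblt
      rw [← ha b hab, h b (hia.trans hab)] at this
      exact lt_irrefl _ this
    · exact lt_asymm halt hblt
    · rw [hb a hab] at halt
      exact lt_irrefl _ halt
  exact fun j hj => (ha j (ha'.trans_lt hj)).symm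

end OrderedBratteliDiagram

/-- A family of edges that is a path from level `k` on can be changed below level `k` to a path. -/
theorem BratteliDiagram.exists_path_eq_of_le {B : BratteliDiagram} (k : ℕ) (f : ∀ k, B.E k)
    (hf : ∀ j, k ≤ j → B.target (j + 1) (f (j + 1)) = B.source j (f j)) :
    ∃ p : B.PathSpace, ∀ j, k ≤ j → p.1 j = f j := by
  induction k generalizing f with
  | zero => exact ⟨⟨f, fun j => hf j (Nat.zero_le j)⟩, fun j _ => rfl⟩
  | succ k ih =>
    obtain ⟨e, he⟩ := B.source_surjective k (B.target (k + 1) (f (k + 1)))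
    obtain ⟨p, hp⟩ := ih (Function.update f k e) fun j hj => by
      rw [Function.update_of_ne (by omega)]
      rcases hj.eq_or_lt with rfl | hj
      · rw [Function.update_self, he]
      · rw [Function.update_of_ne (by omega), hf j hj]
    exact ⟨p, fun j hj => by rw [hp j (by omega), Function.update_of_ne (by omega)]⟩

namespace OrderedBratteliDiagram

variable {B : OrderedBratteliDiagram}

theorem source_eq_of_le {k : ℕ} {e e' : B.E k} (h : e ≤ e') : B.source k e = B.source k e' :=
  (B.comparable_iff k e e').mp (Or.inl h)

theorem exists_isSuccessor {p : B.PathSpace} {i : ℕ} {e : B.E i} (he : p.1 i < e) :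
    ∃ q, B.IsSuccessor p q := by
  -- only finitely many paths agree with `p` beyond `i`
  let R : Set B.PathSpace := {r | (∀ j, i < j → r.1 j = p.1 j) ∧ B.Precedes p r}
  have hfin : R.Finite := by
    have := fun k => B.finite_E k
    refine Finite.of_injOn (f := fun r (j : Fin (i + 1)) => r.1 j) (t := univ)
      (mapsTo_univ _ _) ?_ finite_univ
    intro r hr s hs hrs
    refine Subtype.ext (funext fun j => ?_)
    by_cases hj : i < j
    · rw [hr.1 j hj, hs.1 j hj]
    · exact congrFun hrs ⟨j, by omega⟩
  have hne : R.Nonempty := by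
    obtain ⟨r, hr⟩ := B.exists_path_eq_of_le i (Function.update p.1 i e) fun j hj => by
      rw [Function.update_of_ne (by omega)]
      rcases hj.eq_or_lt with rfl | hj
      · rw [Function.update_self, ← source_eq_of_le he.le, p.2]
      · rw [Function.update_of_ne (by omega), p.2 j]
    have hrj : ∀ j, i < j → r.1 j = p.1 j := fun j hj => by
      rw [hr j hj.le, Function.update_of_ne (by omega)]
    exact ⟨r, hrj, i, fun j hj => (hrj j hj).symm, by rwa [hr i le_rfl, Function.update_self]⟩
  have hwf : R.WellFoundedOn B.Precedes :=
    have : IsStrictOrder B.PathSpace B.Precedes :=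
      { irrefl := Precedes.irrefl, trans := fun _ _ _ => Precedes.trans }
    hfin.wellFoundedOn
  obtain ⟨⟨q, hq⟩, -, hmin⟩ := hwf.has_min univ ⟨⟨hne.some, hne.some_mem⟩, trivial⟩
  exact ⟨q, hq.2, fun s ⟨hps, hsq⟩ => hmin ⟨s, hps.eq_of_between hsq hq.1, hps⟩ trivial hsq⟩

theorem not_isMaximal_iff {p : B.PathSpace} : ¬ B.IsMaximal p ↔ ∃ i, ∃ e, p.1 i < e :=
  ⟨fun h => let ⟨_, ⟨i, _, hi⟩, _⟩ := not_not.mp h; ⟨i, _, hi⟩,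
    fun ⟨_, _, he⟩ => not_not.mpr (exists_isSuccessor he)⟩

theorem isClosed_setOf_isMaximal : IsClosed {p : B.PathSpace | B.IsMaximal p} := by
  rw [← isOpen_compl_iff, isOpen_iff_mem_nhds]
  intro p hp
  obtain ⟨i, e, he⟩ := not_isMaximal_iff.mp hp
  let : ∀ k, TopologicalSpace (B.E k) := fun _ => ⊥
  have : ∀ k, DiscreteTopology (B.E k) := fun _ => ⟨rfl⟩
  have hcont : Continuous fun q : B.PathSpace => q.1 i :=
    (continuous_apply i).comp continuous_induced_dom
  filter_upwards [hcont.continuousAt.preimage_mem_nhds ((isOpen_discrete {p.1 i}).mem_nhds rfl)]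
    with q hq
  have hq' : q.1 i = p.1 i := hq
  exact not_isMaximal_iff.mpr ⟨i, e, hq' ▸ he⟩

/-- The Vershik map increases in the order of the path space, so no periodic orbit of a prolongation
consists of non-maximal paths only. -/
theorem Prolongs.exists_isMaximal_iterate {S : B.PathSpace ≃ₜ B.PathSpace} (hS : B.Prolongs S)
    {p : B.PathSpace} (hp : p ∈ Function.periodicPts S) : ∃ n, B.IsMaximal (S^[n] p) := by
  by_contra! hno
  have hlt : ∀ n, B.Precedes p (S^[n + 1] p) := by
    intro n
    have hstep : ∀ n, B.Precedes (S^[n] p) (S^[n + 1] p) := fun n => by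
      rw [Function.iterate_succ_apply', hS ⟨S^[n] p, hno n⟩]
      exact ((vershikMap_eq_iff ⟨S^[n] p, hno n⟩ _).mp rfl).1
    induction n with
    | zero => exact hstep 0
    | succ n ih => exact ih.trans (hstep (n + 1))
  obtain ⟨_ | n, hn, hpn⟩ := hp
  · exact absurd hn (lt_irrefl 0)
  · have := hlt n
    rw [hpn] at this
    exact this.irrefl p

end OrderedBratteliDiagram

theorem BratteliVershikizable.dense_or_existsUnique {X : Type*} [TopologicalSpace X]
    [CompactSpace X] [MetrizableSpace X] [TotallyDisconnectedSpace X] {T : X ≃ₜ X}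
    (hT : BratteliVershikizable T) :
    Dense (aperiodicPts T) ∨
      ∃! O : Set X, IsPeriodicOrbit T O ∧ Disjoint O (closure (aperiodicPts T)) := by
  obtain ⟨B, ⟨S₀, -, hS₀⟩, S, hS, h, hconj⟩ := hT
  have hiter : ∀ n x, h (T^[n] x) = S^[n] (h x) := fun n =>
    (show Function.Semiconj h T S from hconj).iterate_right n
  refine dense_aperiodicPts_or_existsUnique T (M := h ⁻¹' {p | B.IsMaximal p})
    (OrderedBratteliDiagram.isClosed_setOf_isMaximal.preimage h.continuous) ?_ ?_
  · intro T' hT'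
    have hS' : (h.symm.trans T').trans h = S := by
      rw [hS₀ S hS]
      refine hS₀ _ fun p => ?_
      have := hT' (h.symm p.1) (by simpa using p.2)
      simp only [Homeomorph.trans_apply, this, hconj, Homeomorph.apply_symm_apply]
      exact hS p
    ext x
    apply h.injective
    rw [hconj, ← hS']
    simp
  · intro x hx
    have hx' : h x ∈ Function.periodicPts S := Function.Semiconj.mapsTo_periodicPts hconj hx
    obtain ⟨n, hn⟩ := hS.exists_isMaximal_iterate hx'
    exact ⟨n, by rwa [mem_preimage, hiter]⟩

/-! ### Decreasing sequences of base sets -/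

section BaseSets

variable {X : Type*} [TopologicalSpace X] {T : X ≃ₜ X}

theorem Homeomorph.zpow_apply_zpow_apply {a b c : ℤ} (h : a + b = c) (x : X) :
    (T ^ a) ((T ^ b) x) = (T ^ c) x := by
  rw [← h, zpow_add]
  rfl

theorem Homeomorph.zpow_natCast_apply (n : ℕ) (x : X) : (T ^ (n : ℤ)) x = T^[n] x := by
  rw [zpow_natCast, Homeomorph.pow_apply_eq_iterate]

/-- An open set that meets every orbit meets every backward orbit within bounded time. -/
theorem exists_bound_backward_visit [CompactSpace X] {B : Set X} (hB : IsOpen B)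
    (hit : ∀ x, ∃ n : ℤ, (T ^ n) x ∈ B) :
    ∃ N : ℕ, ∀ x, ∃ j : ℕ, j ≤ N ∧ (T ^ (-(j : ℤ))) x ∈ B := by
  obtain ⟨t, ht⟩ := isCompact_univ.elim_finite_subcover (fun n : ℤ => ⇑(T ^ n) ⁻¹' B)
    (fun n => hB.preimage (T ^ n).continuous) fun x _ => mem_iUnion.mpr (hit x)
  obtain ⟨M, hM⟩ : ∃ M : ℕ, ∀ n ∈ t, n.natAbs ≤ M :=
    ⟨t.sup Int.natAbs, fun n hn => Finset.le_sup (f := Int.natAbs) hn⟩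
  refine ⟨2 * M, fun x => ?_⟩
  obtain ⟨n, hn, hx⟩ := mem_iUnion₂.mp (ht (mem_univ ((T ^ (-(M : ℤ))) x)))
  have := hM n hn
  refine ⟨(M - n).toNat, by omega, ?_⟩
  have hx' : (T ^ n) ((T ^ (-(M : ℤ))) x) ∈ B := hx
  rwa [Homeomorph.zpow_apply_zpow_apply (c := -((M - n).toNat : ℤ)) (by omega)] at hx'

/-- Shrinking a base set: a small neighbourhood of an aperiodic point can be removed from a clopen
set that meets every orbit, since the orbit of that point meets the set elsewhere too. -/
theorem exists_isClopen_subset_not_superset [CompactSpace X] [T2Space X]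
    [TotallyDisconnectedSpace X] {B W : Set X} (hB : IsClopen B)
    (hit : ∀ x, ∃ n : ℤ, (T ^ n) x ∈ B) (hWT : (W ∩ aperiodicPts T).Nonempty) :
    ∃ B' ⊆ B, IsClopen B' ∧ (∀ x, ∃ n : ℤ, (T ^ n) x ∈ B') ∧ ¬ W ⊆ B' := by
  obtain ⟨x, hxW, hx⟩ := hWT
  by_cases hxB : x ∈ B
  · obtain ⟨N, hN⟩ := exists_bound_backward_visit hB.isOpen hit
    obtain ⟨j, hjN, hj⟩ := hN ((T ^ ((N : ℤ) + 1)) x)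
    -- the orbit of `x` visits `B` at the time `k ≥ 1` as well
    obtain ⟨k, hk, hkB⟩ : ∃ k : ℕ, 0 < k ∧ (T ^ (k : ℤ)) x ∈ B := by
      refine ⟨N + 1 - j, by omega, ?_⟩
      rwa [Homeomorph.zpow_apply_zpow_apply (c := ((N + 1 - j : ℕ) : ℤ)) (by omega)] at hj
    have hkx : (T ^ (k : ℤ)) x ≠ x := fun h => hx ⟨k, hk, by
      rwa [Homeomorph.zpow_natCast_apply] at h⟩
    obtain ⟨P, Q, hP, hQ, hkP, hxQ, hPQ⟩ := t2_separation hkx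
    have hcont : Continuous ⇑(T ^ (k : ℤ)) := (T ^ (k : ℤ)).continuous
    obtain ⟨C, hC, hxC, hCsub⟩ := compact_exists_isClopen_in_isOpen
      (hQ.inter ((hP.inter hB.isOpen).preimage hcont)) ⟨hxQ, hkP, hkB⟩
    refine ⟨B \ C, sdiff_subset, hB.diff hC, fun y => ?_, fun h => (h hxW).2 hxC⟩
    obtain ⟨n, hn⟩ := hit y
    by_cases hnC : (T ^ n) y ∈ C
    · obtain ⟨-, hyP, hyB⟩ := hCsub hnC
      refine ⟨k + n, ?_⟩
      rw [← Homeomorph.zpow_apply_zpow_apply rfl]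
      exact ⟨hyB, fun hyC => disjoint_left.mp hPQ hyP (hCsub hyC).1⟩
    · exact ⟨n, hn, hnC⟩
  · exact ⟨B, Subset.rfl, hB, hit, fun h => hxB (h hxW)⟩

/-- Iterating `exists_isClopen_subset_not_superset` along a countable basis, one obtains base sets
below `B₁` whose intersection contains no aperiodic point in its interior. -/
theorem exists_antitone_base [CompactSpace X] [MetrizableSpace X] [TotallyDisconnectedSpace X]
    {B₁ : Set X} (hB₁ : IsClopen B₁) (hit : ∀ x, ∃ n : ℤ, (T ^ n) x ∈ B₁) :
    ∃ B : ℕ → Set X, B 0 = univ ∧ B 1 ⊆ B₁ ∧ Antitone B ∧ (∀ k, IsClopen (B k)) ∧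
      (∀ k x, ∃ n : ℤ, (T ^ n) x ∈ B k) ∧ Disjoint (interior (⋂ k, B k)) (aperiodicPts T) := by
  let := metrizableSpaceMetric X
  obtain ⟨W, hW⟩ := exists_seq_basis X
  have hstep : ∀ (n : ℕ) (B : {B : Set X // IsClopen B ∧ ∀ x, ∃ n : ℤ, (T ^ n) x ∈ B}),
      ∃ B' : {B : Set X // IsClopen B ∧ ∀ x, ∃ n : ℤ, (T ^ n) x ∈ B}, B'.1 ⊆ B.1 ∧
        ((W n ∩ aperiodicPts T).Nonempty → ¬ W n ⊆ B'.1) := by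
    rintro n ⟨B, hB, hBhit⟩
    by_cases hne : (W n ∩ aperiodicPts T).Nonempty
    · obtain ⟨B', hsub, hB', hhit', hnot⟩ := exists_isClopen_subset_not_superset hB hBhit hne
      exact ⟨⟨B', hB', hhit'⟩, hsub, fun _ => hnot⟩
    · exact ⟨⟨B, hB, hBhit⟩, Subset.rfl, fun h => absurd h hne⟩
  choose next hnext using hstep
  let A : ℕ → {B : Set X // IsClopen B ∧ ∀ x, ∃ n : ℤ, (T ^ n) x ∈ B} :=
    fun k => Nat.rec ⟨B₁, hB₁, hit⟩ (fun n B => next n B) k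
  have hA : ∀ n, A (n + 1) = next n (A n) := fun n => rfl
  let B : ℕ → Set X := fun k => k.casesOn univ fun n => (A n).1
  refine ⟨B, rfl, Subset.rfl, antitone_nat_of_succ_le ?_, ?_, ?_, ?_⟩
  · rintro (_ | n)
    · exact subset_univ _
    · exact (hnext n (A n)).1
  · rintro (_ | n)
    · exact isClopen_univ
    · exact (A n).2.1
  · rintro (_ | n)
    · exact fun x => ⟨0, trivial⟩
    · exact (A n).2.2
  · refine disjoint_left.mpr fun x hx hxT => ?_
    obtain ⟨_, ⟨n, rfl⟩, hxW, hWsub⟩ := hW.exists_subset_of_mem_open hx isOpen_interior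
    refine (hnext n (A n)).2 ⟨x, hxW, hxT⟩ fun y hy => ?_
    exact mem_iInter.mp (interior_subset (hWsub hy)) (n + 2)

/-- If the aperiodic points are dense, or exactly one periodic orbit avoids their closure, there are
base sets whose intersection has at most one interior point. In the second case that orbit is open,
and all but one of its points are removed at the outset. -/
theorem exists_antitone_base_subsingleton [CompactSpace X] [MetrizableSpace X]
    [TotallyDisconnectedSpace X] (h : Dense (aperiodicPts T) ∨
      ∃! O : Set X, IsPeriodicOrbit T O ∧ Disjoint O (closure (aperiodicPts T))) :
    ∃ B : ℕ → Set X, B 0 = univ ∧ Antitone B ∧ (∀ k, IsClopen (B k)) ∧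
      (∀ k x, ∃ n : ℤ, (T ^ n) x ∈ B k) ∧ (interior (⋂ k, B k)).Subsingleton := by
  have hcl : ∀ {F : Set X}, Disjoint (interior F) (aperiodicPts T) →
      interior F ⊆ (closure (aperiodicPts T))ᶜ := fun hF =>
    (hF.closure_right isOpen_interior).subset_compl_right
  rcases h with h | ⟨O, ⟨⟨z, hz, rfl⟩, hOdisj⟩, hO⟩
  · obtain ⟨B, h0, -, hanti, hclopen, hhit, hint⟩ :=
      exists_antitone_base isClopen_univ fun x : X => ⟨0, trivial⟩
    refine ⟨B, h0, hanti, hclopen, hhit, ?_⟩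
    have := hcl hint
    rw [h.closure_eq, compl_univ] at this
    exact fun x hx => absurd (this hx) (notMem_empty x)
  · set O : Set X := range fun n : ℕ => T^[n] z with hOdef
    have hOU : O = (closure (aperiodicPts T))ᶜ := by
      refine Subset.antisymm hOdisj.subset_compl_right fun x hx => ?_
      rw [← hO (range fun n : ℕ => T^[n] x) ⟨⟨x, not_not.mp fun h => hx (subset_closure h), rfl⟩, ?_⟩]
      · exact ⟨0, rfl⟩
      · refine disjoint_left.mpr ?_
        rintro _ ⟨n, rfl⟩
        exact fun h => hx ((iterate_mem_closure_aperiodicPts n).mp h)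
    have hOfin : O.Finite := finite_range_iterate hz
    have hOopen : IsOpen O := hOU ▸ isClosed_closure.isOpen_compl
    have hclopen₁ : IsClopen (O \ {z})ᶜ := IsClopen.compl
      ⟨(hOfin.subset sdiff_subset).isClosed, hOopen.sdiff isClosed_singleton⟩
    obtain ⟨B, h0, h1, hanti, hclopen, hhit, hint⟩ :=
      exists_antitone_base (T := T) hclopen₁ fun x => by
        by_cases hx : x ∈ O
        · obtain ⟨n, rfl⟩ := hx
          refine ⟨-n, ?_⟩
          simp only [← Homeomorph.zpow_natCast_apply]
          rw [Homeomorph.zpow_apply_zpow_apply (c := 0) (by omega)]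
          exact fun h => h.2 rfl
        · exact ⟨0, fun h => hx h.1⟩
    refine ⟨B, h0, hanti, hclopen, hhit, ?_⟩
    have hsub : interior (⋂ k, B k) ⊆ {z} := by
      intro x hx
      by_contra hxz
      exact h1 (mem_iInter.mp (interior_subset hx) 1) ⟨hOU ▸ hcl hint hx, hxz⟩
    exact subsingleton_singleton.anti hsub

end BaseSets

/-! ### Nested Kakutani–Rokhlin partitions -/

section Towers

variable {X : Type*} [TopologicalSpace X]

/-- The points `T y, …, T^i y` avoid `B`. -/
def NoReturn (T : X ≃ₜ X) (B : Set X) (y : X) (i : ℕ) : Prop :=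
  ∀ n : ℕ, 0 < n → n ≤ i → (T ^ (n : ℤ)) y ∉ B

theorem NoReturn.mono {T : X ≃ₜ X} {B B' : Set X} {y : X} {i j : ℕ} (h : NoReturn T B y i)
    (hB : B' ⊆ B) (hj : j ≤ i) : NoReturn T B' y j :=
  fun n h0 hn hB' => h n h0 (hn.trans hj) (hB hB')

/-- A nested sequence of Kakutani–Rokhlin partitions of `(X, T)`. The base set `base k` is a
decreasing clopen set met by every backward orbit; it is partitioned according to the value of
`name k`, and the towers of level `k` are the sets of points `T^i y` with `y` in a piece of `base k`
and `i` smaller than the first return time of `y` to `base k`. The pieces of level `k + 1` determine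
how their towers run through those of level `k`, and the towers together separate points. -/
structure TowerSystem (T : X ≃ₜ X) where
  base : ℕ → Set X
  base_zero : base 0 = univ
  base_antitone : Antitone base
  isClopen_base : ∀ k, IsClopen (base k)
  exists_mem_base : ∀ k x, ∃ j : ℕ, (T ^ (-(j : ℤ))) x ∈ base k
  Name : ℕ → Type
  name : ∀ k, X → Name k
  isLocallyConstant_name : ∀ k, IsLocallyConstant (name k)
  /-- level zero consists of a single tower, of height one -/
  name_zero : ∀ x y, name 0 x = name 0 y
  /-- points with equal names have the same first return time -/
  noReturn_of_name_eq : ∀ k, ∀ y ∈ base k, ∀ y' ∈ base k, name k y = name k y' →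
    ∀ i, NoReturn T (base k) y i → NoReturn T (base k) y' i
  /-- a name of level `k + 1` determines the visits to `base k` before the first return … -/
  mem_base_iff : ∀ k, ∀ y ∈ base (k + 1), ∀ y' ∈ base (k + 1), name (k + 1) y = name (k + 1) y' →
    ∀ i : ℕ, NoReturn T (base (k + 1)) y i →
      ((T ^ (i : ℤ)) y ∈ base k ↔ (T ^ (i : ℤ)) y' ∈ base k)
  /-- … and the names of level `k` at these visits -/
  name_eq : ∀ k, ∀ y ∈ base (k + 1), ∀ y' ∈ base (k + 1), name (k + 1) y = name (k + 1) y' →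
    ∀ i : ℕ, NoReturn T (base (k + 1)) y i →
      name k ((T ^ (i : ℤ)) y) = name k ((T ^ (i : ℤ)) y')
  /-- different points eventually lie at different places of the towers -/
  separates : ∀ x x', x ≠ x' → ∃ K, ∀ k, K ≤ k → ∀ y ∈ base k, ∀ y' ∈ base k,
    name k y = name k y' → ∀ i : ℕ, NoReturn T (base k) y i →
      ¬ (x = (T ^ (i : ℤ)) y ∧ x' = (T ^ (i : ℤ)) y')

/-- Given the base sets, names exist: with an enumeration of the clopen sets, the name of `y` records
which of the first `m k` clopen sets contain `y`, where `m` grows fast enough. -/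
theorem exists_towerSystem [CompactSpace X] [MetrizableSpace X] [TotallyDisconnectedSpace X]
    {T : X ≃ₜ X} {B : ℕ → Set X} (h0 : B 0 = univ) (hanti : Antitone B)
    (hclopen : ∀ k, IsClopen (B k)) (hhit : ∀ k x, ∃ n : ℤ, (T ^ n) x ∈ B k) :
    ∃ S : TowerSystem T, S.base = B := by
  classical
  let := metrizableSpaceMetric X
  have : Countable (Clopens X) := Clopens.countable_iff_secondCountable.mpr inferInstance
  obtain ⟨A, hA⟩ := exists_surjective_nat (Clopens X)
  choose N hN using fun k => exists_bound_backward_visit (hclopen k).isOpen (hhit k)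
  have hNbound : ∀ k y i, NoReturn T (B k) y i → i ≤ N k := by
    intro k y i hy
    obtain ⟨j, hj, hjB⟩ := hN k ((T ^ (i : ℤ)) y)
    by_contra! hlt
    rw [Homeomorph.zpow_apply_zpow_apply (c := ((i - j : ℕ) : ℤ)) (by omega)] at hjB
    exact hy (i - j) (by omega) (by omega) hjB
  let name : ∀ m : ℕ, X → Fin m → Bool := fun m y i => decide (y ∈ A i)
  have hname : ∀ {m j : ℕ} {y y' : X}, name m y = name m y' → j < m → (y ∈ A j ↔ y' ∈ A j) := by
    intro m j y y' h hj
    exact decide_eq_decide.mp (congrFun h ⟨j, hj⟩)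
  have hev : ∀ C : Set X, IsClopen C →
      ∀ᶠ m in Filter.atTop, ∀ y y', name m y = name m y' → (y ∈ C ↔ y' ∈ C) := by
    intro C hC
    obtain ⟨j, hj⟩ := hA ⟨C, hC⟩
    filter_upwards [Filter.eventually_gt_atTop j] with m hm y y' h
    have := hname h hm
    rwa [hj] at this
  have hev' : ∀ k (C : Set X), IsClopen C → ∀ᶠ m in Filter.atTop, ∀ i ∈ Iic (N k), ∀ y y',
      name m y = name m y' → ((T ^ (i : ℤ)) y ∈ C ↔ (T ^ (i : ℤ)) y' ∈ C) := by
    intro k C hC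
    rw [Filter.eventually_all_finite (finite_Iic _)]
    exact fun i _ => hev _ (hC.preimage (T ^ (i : ℤ)).continuous)
  have hstep : ∀ k a, ∃ m, ∀ i ∈ Iic (N (k + 1)), ∀ y y', name m y = name m y' →
      ((T ^ (i : ℤ)) y ∈ B (k + 1) ↔ (T ^ (i : ℤ)) y' ∈ B (k + 1)) ∧
      ((T ^ (i : ℤ)) y ∈ B k ↔ (T ^ (i : ℤ)) y' ∈ B k) ∧
      ∀ j ∈ Iio (max a (k + 1)), ((T ^ (i : ℤ)) y ∈ A j ↔ (T ^ (i : ℤ)) y' ∈ A j) := by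
    intro k a
    have hall := (Filter.eventually_all_finite (finite_Iio (max a (k + 1)))).mpr fun j _ =>
      hev' (k + 1) _ (A j).isClopen
    obtain ⟨m, h1, h2, h3⟩ := ((hev' (k + 1) _ (hclopen (k + 1))).and
      ((hev' (k + 1) _ (hclopen k)).and hall)).exists
    exact ⟨m, fun i hi y y' h => ⟨h1 i hi y y' h, h2 i hi y y' h, fun j hj => h3 j hj i hi y y' h⟩⟩
  choose next hnext using hstep
  obtain ⟨m, hm0, hm⟩ : ∃ m : ℕ → ℕ, m 0 = 0 ∧
      ∀ k, ∀ i ≤ N (k + 1), ∀ y y', name (m (k + 1)) y = name (m (k + 1)) y' →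
      ((T ^ (i : ℤ)) y ∈ B (k + 1) ↔ (T ^ (i : ℤ)) y' ∈ B (k + 1)) ∧
      ((T ^ (i : ℤ)) y ∈ B k ↔ (T ^ (i : ℤ)) y' ∈ B k) ∧
      ∀ j < max (m k) (k + 1), ((T ^ (i : ℤ)) y ∈ A j ↔ (T ^ (i : ℤ)) y' ∈ A j) :=
    ⟨fun k => Nat.rec (motive := fun _ => ℕ) 0 next k, rfl, fun k => hnext k _⟩
  refine ⟨{
    base := B
    base_zero := h0
    base_antitone := hanti
    isClopen_base := hclopen
    exists_mem_base := fun k x => (hN k x).imp fun j hj => hj.2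
    Name := fun k => Fin (m k) → Bool
    name := fun k => name (m k)
    isLocallyConstant_name := ?_
    name_zero := fun x y => funext fun i => absurd i.2 (by omega)
    noReturn_of_name_eq := ?_
    mem_base_iff := ?_
    name_eq := ?_
    separates := ?_ }, rfl⟩
  · refine fun k => (IsLocallyConstant.iff_eventually_eq _).mpr fun x => ?_
    have : ∀ᶠ y in 𝓝 x, ∀ i : Fin (m k), (y ∈ A i.val ↔ x ∈ A i.val) := by
      rw [Filter.eventually_all]
      intro i
      exact (A i.val).isClopen.eventually_mem_iff x
    filter_upwards [this] with y hy
    exact funext fun i => decide_eq_decide.mpr (hy i)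
  · rintro (_ | k) y - y' - h i hi
    · have : i = 0 := by
        by_contra hne
        exact hi 1 one_pos (Nat.pos_of_ne_zero hne) (h0 ▸ trivial)
      exact fun n h0 hn => absurd h0 (by omega)
    · exact fun n hn0 hn hmem => hi n hn0 hn
        ((hm k n (hn.trans (hNbound _ _ _ hi)) y y' h).1.mpr hmem)
  · intro k y _ y' _ h i hi
    exact (hm k i (hNbound _ _ _ hi) y y' h).2.1
  · intro k y _ y' _ h i hi
    exact funext fun j => decide_eq_decide.mpr
      ((hm k i (hNbound _ _ _ hi) y y' h).2.2 j.val (lt_max_of_lt_left j.2))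
  · intro x x' hne
    obtain ⟨U, hU, hxU, hxU'⟩ := exists_isClopen_of_totally_separated hne
    obtain ⟨j, hj⟩ := hA ⟨U, hU⟩
    refine ⟨j + 1, fun k hk y _ y' _ h i hi => ?_⟩
    rintro ⟨rfl, rfl⟩
    obtain ⟨k, rfl⟩ : ∃ l, k = l + 1 := ⟨k - 1, by omega⟩
    have := (hm k i (hNbound _ _ _ hi) y y' h).2.2 j (lt_max_of_lt_right (by omega))
    rw [hj] at this
    exact hxU' (this.mp hxU)

/-! ### Heights and cells -/

namespace TowerSystem

variable {T : X ≃ₜ X} (S : TowerSystem T)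

open Classical in
/-- The height of `x` in its tower of level `k`: the time since the last visit to `base k`. -/
noncomputable def height (k : ℕ) (x : X) : ℕ := Nat.find (S.exists_mem_base k x)

/-- The point of `base k` at the bottom of the tower of level `k`, below `x`. -/
noncomputable def foot (k : ℕ) (x : X) : X := (T ^ (-(S.height k x : ℤ))) x

/-- The name of the tower of level `k` that contains `x`. -/
noncomputable def cell (k : ℕ) (x : X) : S.Name k := S.name k (S.foot k x)

theorem foot_mem (k : ℕ) (x : X) : S.foot k x ∈ S.base k := by
  classical exact Nat.find_spec (S.exists_mem_base k x)

theorem height_le_of_mem {k j : ℕ} {x : X} (h : (T ^ (-(j : ℤ))) x ∈ S.base k) :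
    S.height k x ≤ j := by
  classical exact Nat.find_min' _ h

theorem zpow_height_foot (k : ℕ) (x : X) : (T ^ (S.height k x : ℤ)) (S.foot k x) = x := by
  rw [foot, Homeomorph.zpow_apply_zpow_apply (c := 0) (by omega)]
  rfl

theorem noReturn_foot (k : ℕ) (x : X) : NoReturn T (S.base k) (S.foot k x) (S.height k x) := by
  intro n h0 hn hmem
  rw [foot, Homeomorph.zpow_apply_zpow_apply (c := -((S.height k x - n : ℕ) : ℤ)) (by omega)]
    at hmem
  have := S.height_le_of_mem hmem
  omega

theorem height_zpow {k i : ℕ} {y : X} (hy : y ∈ S.base k) (h : NoReturn T (S.base k) y i) :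
    S.height k ((T ^ (i : ℤ)) y) = i := by
  have hle : S.height k ((T ^ (i : ℤ)) y) ≤ i := S.height_le_of_mem (by
    rw [Homeomorph.zpow_apply_zpow_apply (c := 0) (by omega)]; exact hy)
  by_contra hne
  have hmem := S.foot_mem k ((T ^ (i : ℤ)) y)
  rw [foot, Homeomorph.zpow_apply_zpow_apply
    (c := ((i - S.height k ((T ^ (i : ℤ)) y) : ℕ) : ℤ)) (by omega)] at hmem
  exact h _ (by omega) (by omega) hmem

theorem foot_zpow {k i : ℕ} {y : X} (hy : y ∈ S.base k) (h : NoReturn T (S.base k) y i) :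
    S.foot k ((T ^ (i : ℤ)) y) = y := by
  rw [foot, S.height_zpow hy h, Homeomorph.zpow_apply_zpow_apply (c := 0) (by omega)]
  rfl

theorem noReturn_of_cell_eq {k i : ℕ} {x x' : X} (h : S.cell k x = S.cell k x')
    (hi : NoReturn T (S.base k) (S.foot k x) i) : NoReturn T (S.base k) (S.foot k x') i :=
  S.noReturn_of_name_eq k _ (S.foot_mem k x) _ (S.foot_mem k x') h i hi

theorem height_mono (x : X) : Monotone fun k => S.height k x :=
  fun _ l hkl => S.height_le_of_mem (S.base_antitone hkl (S.foot_mem l x))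

theorem height_zero (x : X) : S.height 0 x = 0 :=
  Nat.le_zero.mp (S.height_le_of_mem (by rw [S.base_zero]; trivial))

/-- The foot of level `k` is reached from the foot of level `k + 1`. -/
theorem zpow_foot_succ (k : ℕ) (x : X) :
    (T ^ ((S.height (k + 1) x - S.height k x : ℕ) : ℤ)) (S.foot (k + 1) x) = S.foot k x := by
  have : S.height k x ≤ S.height (k + 1) x := S.height_mono x k.le_succ
  rw [foot, foot, Homeomorph.zpow_apply_zpow_apply (c := -(S.height k x : ℤ)) (by omega)]

/-- Along a tower of level `k`, the cell is constant and the height increases by one. -/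
theorem cell_and_height_zpow {k n : ℕ} {x : X} (h : NoReturn T (S.base k) x n) :
    S.cell k ((T ^ (n : ℤ)) x) = S.cell k x ∧
      S.height k ((T ^ (n : ℤ)) x) = S.height k x + n := by
  have hno : NoReturn T (S.base k) (S.foot k x) (S.height k x + n) := by
    intro l hl0 hl hmem
    by_cases hlx : l ≤ S.height k x
    · exact S.noReturn_foot k x l hl0 hlx hmem
    · refine h (l - S.height k x) (by omega) (by omega) ?_
      rw [foot, Homeomorph.zpow_apply_zpow_apply (c := ((l - S.height k x : ℕ) : ℤ)) (by omega)]
        at hmem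
      exact hmem
  have hx : (T ^ (n : ℤ)) x = (T ^ ((S.height k x + n : ℕ) : ℤ)) (S.foot k x) := by
    rw [foot, Homeomorph.zpow_apply_zpow_apply (c := (n : ℤ)) (by omega)]
  rw [cell, hx, S.foot_zpow (S.foot_mem k x) hno, S.height_zpow (S.foot_mem k x) hno]
  exact ⟨rfl, rfl⟩

/-- Points of the same tower of level `k + 1` at heights that exceed those of level `k` by the same
amount lie in the same tower of level `k`. -/
theorem cell_eq_of_succ {k : ℕ} {x x' : X} (h : S.cell (k + 1) x = S.cell (k + 1) x')
    (hh : S.height (k + 1) x - S.height k x = S.height (k + 1) x' - S.height k x') :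
    S.cell k x = S.cell k x' := by
  rw [cell, cell, ← S.zpow_foot_succ k x, ← S.zpow_foot_succ k x', ← hh]
  exact S.name_eq k _ (S.foot_mem _ x) _ (S.foot_mem _ x') h _
    ((S.noReturn_foot (k + 1) x).mono Subset.rfl (Nat.sub_le _ _))

theorem height_le_of_succ {k : ℕ} {x x' : X} (h : S.cell (k + 1) x = S.cell (k + 1) x')
    (hh : S.height (k + 1) x = S.height (k + 1) x') : S.height k x' ≤ S.height k x := by
  have hle : S.height k x ≤ S.height (k + 1) x := S.height_mono x k.le_succ
  refine S.height_le_of_mem ?_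
  have hmem := (S.mem_base_iff k _ (S.foot_mem _ x) _ (S.foot_mem _ x') h
    (S.height (k + 1) x - S.height k x)
    ((S.noReturn_foot (k + 1) x).mono Subset.rfl (Nat.sub_le _ _))).mp
    (by rw [S.zpow_foot_succ]; exact S.foot_mem k x)
  rwa [foot, Homeomorph.zpow_apply_zpow_apply (c := -(S.height k x : ℤ)) (by omega)] at hmem

/-- Towers of level `l` refine those of lower levels. -/
theorem cell_and_height_eq_of_le {k l : ℕ} (hkl : k ≤ l) {x x' : X} (h : S.cell l x = S.cell l x')
    (hh : S.height l x = S.height l x') :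
    S.cell k x = S.cell k x' ∧ S.height k x = S.height k x' := by
  induction l, hkl using Nat.le_induction with
  | base => exact ⟨h, hh⟩
  | succ l _ ih =>
    have hl : S.height l x = S.height l x' :=
      (S.height_le_of_succ h.symm hh.symm).antisymm (S.height_le_of_succ h hh)
    exact ih (S.cell_eq_of_succ h (by rw [hh, hl])) hl

theorem eq_of_cell_eq {K : ℕ} {x x' : X}
    (h : ∀ k, K ≤ k → S.cell k x = S.cell k x' ∧ S.height k x = S.height k x') : x = x' := by
  by_contra hne
  obtain ⟨L, hL⟩ := S.separates x x' hne
  obtain ⟨hc, hh⟩ := h (max K L) (le_max_left _ _)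
  refine hL (max K L) (le_max_right _ _) _ (S.foot_mem _ x) _ (S.foot_mem _ x') hc _
    (S.noReturn_foot _ x) ⟨(S.zpow_height_foot _ x).symm, ?_⟩
  rw [hh]
  exact (S.zpow_height_foot _ x').symm

theorem isLocallyConstant_height (k : ℕ) : IsLocallyConstant (S.height k) := by
  refine (IsLocallyConstant.iff_eventually_eq _).mpr fun x => ?_
  have hev : ∀ᶠ y in 𝓝 x, ∀ j ∈ Iic (S.height k x),
      ((T ^ (-(j : ℤ))) y ∈ S.base k ↔ (T ^ (-(j : ℤ))) x ∈ S.base k) := by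
    rw [Filter.eventually_all_finite (finite_Iic _)]
    exact fun j _ =>
      ((S.isClopen_base k).preimage (T ^ (-(j : ℤ))).continuous).eventually_mem_iff x
  filter_upwards [hev] with y hy
  have hle : S.height k y ≤ S.height k x :=
    S.height_le_of_mem ((hy _ (mem_Iic.mpr le_rfl)).mpr (S.foot_mem k x))
  exact hle.antisymm (S.height_le_of_mem ((hy _ hle).mp (S.foot_mem k y)))

theorem isLocallyConstant_cell (k : ℕ) : IsLocallyConstant (S.cell k) := by
  refine (IsLocallyConstant.iff_eventually_eq _).mpr fun x => ?_
  have hname := (S.isLocallyConstant_name k).comp_continuous (T ^ (-(S.height k x : ℤ))).continuous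
  filter_upwards [(S.isLocallyConstant_height k).eventually_eq x, hname.eventually_eq x]
    with y hy hy'
  rw [cell, foot, hy]
  exact hy'

end TowerSystem

end Towers

/-! ### The ordered Bratteli diagram of a tower system -/

section Diagram

namespace TowerSystem

variable {X : Type*} [TopologicalSpace X] {T : X ≃ₜ X} (S : TowerSystem T)

/-- The tower of level `k + 1` that contains `x`, together with the height in it of the foot of level
`k`: this tells which passage of the tower of level `k + 1` through towers of level `k` holds `x`. -/
noncomputable def edge (k : ℕ) (x : X) : S.Name (k + 1) × ℕ :=
  (S.cell (k + 1) x, S.height (k + 1) x - S.height k x)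

theorem cell_eq_of_edge_eq {k : ℕ} {x x' : X} (h : S.edge k x = S.edge k x') :
    S.cell k x = S.cell k x' :=
  S.cell_eq_of_succ (Prod.ext_iff.mp h).1 (Prod.ext_iff.mp h).2

theorem isLocallyConstant_edge (k : ℕ) : IsLocallyConstant (S.edge k) :=
  (S.isLocallyConstant_cell (k + 1)).prodMk ((S.isLocallyConstant_height (k + 1)).comp₂
    (S.isLocallyConstant_height k) (· - ·))

/-- If `x` and `y` lie in the same tower of level `n`, some point lies at the place of `y` in that
tower, during the same passage of level `n` as `x`. -/
theorem exists_edge_eq {n : ℕ} {x y : X} (h : S.cell n x = S.cell n y) :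
    ∃ z, S.cell n z = S.cell n y ∧ S.height n z = S.height n y ∧ S.edge n z = S.edge n x := by
  have hno : NoReturn T (S.base n) (S.foot n x) (S.height n y) :=
    S.noReturn_of_cell_eq h.symm (S.noReturn_foot n y)
  set i := S.height (n + 1) x - S.height n x
  have hi : (T ^ (i : ℤ)) (S.foot (n + 1) x) = S.foot n x := S.zpow_foot_succ n x
  have hno' : NoReturn T (S.base (n + 1)) (S.foot (n + 1) x) (i + S.height n y) := by
    intro l hl0 hl hmem
    by_cases hli : l ≤ i
    · exact S.noReturn_foot (n + 1) x l hl0 (hli.trans (Nat.sub_le _ _)) hmem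
    · refine hno (l - i) (by omega) (by omega) (S.base_antitone n.le_succ ?_)
      rwa [← hi, Homeomorph.zpow_apply_zpow_apply (c := (l : ℤ)) (by omega)]
  have hz : (T ^ (S.height n y : ℤ)) (S.foot n x) =
      (T ^ ((i + S.height n y : ℕ) : ℤ)) (S.foot (n + 1) x) := by
    rw [← hi, Homeomorph.zpow_apply_zpow_apply (c := ((i + S.height n y : ℕ) : ℤ)) (by omega)]
  have hheight : S.height n ((T ^ (S.height n y : ℤ)) (S.foot n x)) = S.height n y :=
    S.height_zpow (S.foot_mem n x) hno
  refine ⟨(T ^ (S.height n y : ℤ)) (S.foot n x), ?_, hheight, ?_⟩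
  · rw [← h, cell, S.foot_zpow (S.foot_mem n x) hno, cell]
  · refine Prod.ext ?_ ?_
    · change S.name (n + 1) (S.foot (n + 1) _) = _
      rw [hz, S.foot_zpow (S.foot_mem _ x) hno']
      rfl
    · change S.height (n + 1) _ - S.height n _ = i
      rw [hheight, hz, S.height_zpow (S.foot_mem _ x) hno']
      omega

/-- If from level `K` on `x` and `y` lie in the same towers, with `y` above `x` by a constant amount,
then `y` lies on the forward orbit of `x`. -/
theorem noReturn_and_eq_zpow {K n : ℕ} {x y : X} (h : ∀ k, K ≤ k → S.cell k x = S.cell k y ∧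
    S.height k y = S.height k x + n) : NoReturn T (S.base K) x n ∧ y = (T ^ (n : ℤ)) x := by
  have hno : ∀ k, K ≤ k → NoReturn T (S.base k) x n := by
    intro k hk m hm0 hmn hmem
    have hfoot := S.noReturn_of_cell_eq (h k hk).1.symm (S.noReturn_foot k y)
    refine hfoot (S.height k x + m) (by omega) (by have := (h k hk).2; omega) ?_
    rwa [foot, Homeomorph.zpow_apply_zpow_apply (c := (m : ℤ)) (by omega)]
  refine ⟨hno K le_rfl, S.eq_of_cell_eq (K := K) fun k hk => ?_⟩
  obtain ⟨hc, hh⟩ := S.cell_and_height_zpow (hno k hk)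
  rw [hc, hh, (h k hk).1, (h k hk).2]
  exact ⟨rfl, rfl⟩

variable [CompactSpace X] [Nonempty X]

/-- The ordered Bratteli diagram of a tower system: the vertices are the towers, and the edges with
source a tower of level `k + 1` are its passages through towers of level `k`, ordered by height. -/
noncomputable def diagram : OrderedBratteliDiagram where
  V k := range (S.cell k)
  E k := range (S.edge k)
  finite_V k := (S.isLocallyConstant_cell k).range_finite.to_subtype
  finite_E k := (S.isLocallyConstant_edge k).range_finite.to_subtype
  root := ⟨⟨⟨_, mem_range_self (Classical.arbitrary X)⟩⟩, ⟨by
    rintro ⟨_, x, rfl⟩ ⟨_, y, rfl⟩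
    exact Subtype.ext (S.name_zero _ _)⟩⟩
  source k e := ⟨e.1.1, by obtain ⟨_, x, rfl⟩ := e; exact mem_range_self x⟩
  target k e := ⟨S.cell k e.2.choose, mem_range_self _⟩
  target_surjective k := by
    rintro ⟨_, x, rfl⟩
    exact ⟨⟨_, mem_range_self x⟩,
      Subtype.ext (S.cell_eq_of_edge_eq (mem_range_self (f := S.edge k) x).choose_spec)⟩
  source_surjective k := by
    rintro ⟨_, x, rfl⟩
    exact ⟨⟨_, mem_range_self x⟩, rfl⟩
  edgeOrder k :=
    { le := fun e e' => e.1.1 = e'.1.1 ∧ e.1.2 ≤ e'.1.2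
      le_refl := fun _ => ⟨rfl, le_rfl⟩
      le_trans := fun _ _ _ h h' => ⟨h.1.trans h'.1, h.2.trans h'.2⟩
      le_antisymm := fun _ _ h h' => Subtype.ext (Prod.ext h.1 (h.2.antisymm h'.2)) }
  comparable_iff k e e' :=
    ⟨fun h => Subtype.ext (h.elim (fun h => h.1) fun h => h.1.symm), fun h =>
      have h' : e.1.1 = e'.1.1 := congrArg Subtype.val h
      (le_total e.1.2 e'.1.2).imp (fun hle => ⟨h', hle⟩) fun hle => ⟨h'.symm, hle⟩⟩

/-- The edge of level `k` on the path of `x`. -/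
noncomputable def edgeOf (k : ℕ) (x : X) : S.diagram.E k := ⟨S.edge k x, mem_range_self x⟩

theorem edgeOf_eq_iff {k : ℕ} {x x' : X} :
    S.edgeOf k x = S.edgeOf k x' ↔ S.edge k x = S.edge k x' := Subtype.ext_iff

theorem edgeOf_lt_iff {k : ℕ} {x x' : X} :
    S.edgeOf k x < S.edgeOf k x' ↔ S.cell (k + 1) x = S.cell (k + 1) x' ∧
      S.height (k + 1) x - S.height k x < S.height (k + 1) x' - S.height k x' := by
  have hle : ∀ y y', S.edgeOf k y ≤ S.edgeOf k y' ↔ S.cell (k + 1) y = S.cell (k + 1) y' ∧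
      S.height (k + 1) y - S.height k y ≤ S.height (k + 1) y' - S.height k y' := fun _ _ => Iff.rfl
  rw [lt_iff_le_not_ge, hle, hle]
  constructor
  · rintro ⟨⟨h, -⟩, hnot⟩
    exact ⟨h, by by_contra hlt; exact hnot ⟨h.symm, by omega⟩⟩
  · rintro ⟨h, hlt⟩
    exact ⟨⟨h, hlt.le⟩, fun h' => by omega⟩

theorem target_edgeOf (k : ℕ) (x : X) :
    S.diagram.target k (S.edgeOf k x) = ⟨S.cell k x, mem_range_self x⟩ :=
  Subtype.ext (S.cell_eq_of_edge_eq (mem_range_self (f := S.edge k) x).choose_spec)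

/-- The path of a point: the sequence of its passages. -/
noncomputable def path (x : X) : S.diagram.PathSpace :=
  ⟨fun k => S.edgeOf k x, fun k => S.target_edgeOf (k + 1) x⟩

theorem path_injective : Function.Injective S.path := by
  intro x x' h
  have hedge : ∀ k, S.edge k x = S.edge k x' := fun k =>
    S.edgeOf_eq_iff.mp (congrFun (congrArg Subtype.val h) k)
  have hheight : ∀ k, S.height k x = S.height k x' := by
    intro k
    induction k with
    | zero => rw [S.height_zero, S.height_zero]
    | succ k ih =>
      have h1 : S.height k x ≤ S.height (k + 1) x := S.height_mono x k.le_succ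
      have h2 : S.height k x' ≤ S.height (k + 1) x' := S.height_mono x' k.le_succ
      have h3 : S.height (k + 1) x - S.height k x = S.height (k + 1) x' - S.height k x' :=
        (Prod.ext_iff.mp (hedge k)).2
      omega
  exact S.eq_of_cell_eq (K := 0) fun k _ => ⟨S.cell_eq_of_edge_eq (hedge k), hheight k⟩

theorem path_surjective : Function.Surjective S.path := by
  intro p
  choose x hx using fun k => (p.1 k).2
  have hpx : ∀ k, p.1 k = S.edgeOf k (x k) := fun k => Subtype.ext (hx k).symm
  have hne : ∀ n, ∃ y, ∀ k < n, S.edge k y = S.edge k (x k) := by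
    intro n
    induction n with
    | zero => exact ⟨Classical.arbitrary X, fun k hk => absurd hk (Nat.not_lt_zero k)⟩
    | succ n ih =>
      obtain ⟨y, hy⟩ := ih
      have hcell : S.cell n (x n) = S.cell n y := by
        cases n with
        | zero => exact S.name_zero _ _
        | succ n =>
          have h1 := p.2 n
          rw [hpx, hpx, S.target_edgeOf] at h1
          exact (congrArg Subtype.val h1).trans (Prod.ext_iff.mp (hy n n.lt_succ_self)).1.symm
      obtain ⟨z, hzc, hzh, hze⟩ := S.exists_edge_eq hcell
      refine ⟨z, fun k hk => ?_⟩
      rcases Nat.lt_succ_iff_lt_or_eq.mp hk with hk | rfl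
      · rw [← hy k hk]
        obtain ⟨hc1, hh1⟩ := S.cell_and_height_eq_of_le (show k + 1 ≤ n from hk) hzc hzh
        obtain ⟨-, hh2⟩ := S.cell_and_height_eq_of_le hk.le hzc hzh
        exact Prod.ext hc1 (by change _ - _ = _ - _; rw [hh1, hh2])
      · exact hze
  have hclosed : ∀ n, IsClosed {y | ∀ k < n, S.edge k y = S.edge k (x k)} := by
    intro n
    simp only [ofPred_forall]
    exact isClosed_iInter fun k => isClosed_iInter fun _ =>
      (S.isLocallyConstant_edge k).isClosed_fiber _
  obtain ⟨y, hy⟩ := IsCompact.nonempty_iInter_of_sequence_nonempty_isCompact_isClosed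
    (fun n => {y | ∀ k < n, S.edge k y = S.edge k (x k)})
    (fun n y hy k hk => hy k (hk.trans n.lt_succ_self)) hne (hclosed 0).isCompact hclosed
  refine ⟨y, Subtype.ext (funext fun k => ?_)⟩
  rw [hpx]
  exact S.edgeOf_eq_iff.mpr (mem_iInter.mp hy (k + 1) k k.lt_succ_self)

/-- The paths of the diagram are in bijection with the points of the space, homeomorphically. -/
noncomputable def pathHomeomorph : X ≃ₜ S.diagram.PathSpace :=
  let : ∀ k, TopologicalSpace (S.diagram.E k) := fun _ => ⊥
  have : ∀ k, DiscreteTopology (S.diagram.E k) := fun _ => ⟨rfl⟩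
  have : T2Space S.diagram.PathSpace :=
    T2Space.of_injective_continuous Subtype.val_injective continuous_induced_dom
  have hcont : Continuous S.path := continuous_induced_rng.mpr (continuous_pi fun k =>
    ((IsLocallyConstant.iff_eventually_eq _).mpr fun x =>
      ((S.isLocallyConstant_edge k).eventually_eq x).mono fun _ hy =>
        S.edgeOf_eq_iff.mpr hy).continuous)
  Continuous.homeoOfEquivCompactToT2
    (f := Equiv.ofBijective S.path ⟨S.path_injective, S.path_surjective⟩) hcont

theorem pathHomeomorph_apply (x : X) : S.pathHomeomorph x = S.path x := rfl

/-- Moving up within a tower increases the path. -/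
theorem precedes_path_zpow {K n : ℕ} {x : X} (hn : 0 < n) (h : NoReturn T (S.base K) x n) :
    S.diagram.Precedes (S.path x) (S.path ((T ^ (n : ℤ)) x)) := by
  induction K with
  | zero =>
    refine absurd ?_ (h n hn le_rfl)
    rw [S.base_zero]
    trivial
  | succ l ih =>
    by_cases hl : NoReturn T (S.base l) x n
    · exact ih hl
    · obtain ⟨m, hm0, hmn, hm⟩ : ∃ m : ℕ, 0 < m ∧ m ≤ n ∧ (T ^ (m : ℤ)) x ∈ S.base l := by
        simpa [NoReturn] using hl
      have hup : ∀ k, l < k → S.cell k ((T ^ (n : ℤ)) x) = S.cell k x ∧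
          S.height k ((T ^ (n : ℤ)) x) = S.height k x + n := fun k hk =>
        S.cell_and_height_zpow (h.mono (S.base_antitone hk) le_rfl)
      refine ⟨l, fun j hj => S.edgeOf_eq_iff.mpr (Prod.ext ?_ ?_), S.edgeOf_lt_iff.mpr ⟨?_, ?_⟩⟩
      · exact (hup (j + 1) (by omega)).1.symm
      · change _ - _ = _ - _
        rw [(hup (j + 1) (by omega)).2, (hup j hj).2]
        omega
      · exact (hup (l + 1) (by omega)).1.symm
      · -- the last visit to `base l` happens after time `0`
        have hlt : S.height l ((T ^ (n : ℤ)) x) ≤ n - m := S.height_le_of_mem (by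
          rwa [Homeomorph.zpow_apply_zpow_apply (c := (m : ℤ)) (by omega)])
        have hmono : S.height l x ≤ S.height (l + 1) x := S.height_mono x l.le_succ
        rw [(hup (l + 1) (by omega)).2]
        omega

theorem exists_zpow_of_precedes {x y : X} (h : S.diagram.Precedes (S.path x) (S.path y)) :
    ∃ n K : ℕ, 0 < n ∧ NoReturn T (S.base K) x n ∧ y = (T ^ (n : ℤ)) x := by
  have hxy := h
  obtain ⟨i, hi, hlt⟩ := h
  have hlt' := S.edgeOf_lt_iff.mp hlt
  have hedge : ∀ k, i < k → S.edge k x = S.edge k y := fun k hk => S.edgeOf_eq_iff.mp (hi k hk)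
  have hk : ∀ k, i + 1 ≤ k → S.cell k x = S.cell k y ∧
      S.height k y + S.height (i + 1) x = S.height k x + S.height (i + 1) y := by
    intro k hk
    induction k, hk using Nat.le_induction with
    | base => exact ⟨hlt'.1, by omega⟩
    | succ k hk ih =>
      obtain ⟨h1, h2⟩ := Prod.ext_iff.mp (hedge k hk)
      have h2' : S.height (k + 1) x - S.height k x = S.height (k + 1) y - S.height k y := h2
      have hx : S.height k x ≤ S.height (k + 1) x := S.height_mono x k.le_succ
      have hy : S.height k y ≤ S.height (k + 1) y := S.height_mono y k.le_succ
      exact ⟨h1, by omega⟩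
  rcases lt_or_ge (S.height (i + 1) x) (S.height (i + 1) y) with hh | hh
  · obtain ⟨hno, heq⟩ := S.noReturn_and_eq_zpow (K := i + 1)
      (n := S.height (i + 1) y - S.height (i + 1) x) fun k hik => ⟨(hk k hik).1, by
        have := (hk k hik).2; omega⟩
    exact ⟨_, i + 1, by omega, hno, heq⟩
  -- otherwise `x` lies above `y`, or equals it
  · exfalso
    obtain ⟨hno, heq⟩ := S.noReturn_and_eq_zpow (K := i + 1) (x := y) (y := x)
      (n := S.height (i + 1) x - S.height (i + 1) y) fun k hik => ⟨(hk k hik).1.symm, by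
        have := (hk k hik).2; omega⟩
    rcases Nat.eq_zero_or_pos (S.height (i + 1) x - S.height (i + 1) y) with h0 | hpos
    · rw [h0] at heq
      have heq' : x = y := heq
      subst heq'
      exact OrderedBratteliDiagram.Precedes.irrefl _ hxy
    · have hyx := S.precedes_path_zpow hpos hno
      rw [← heq] at hyx
      exact OrderedBratteliDiagram.Precedes.irrefl _ (hxy.trans hyx)

theorem isSuccessor_path {x : X} (hx : T x ∉ ⋂ k, S.base k) :
    S.diagram.IsSuccessor (S.path x) (S.path (T x)) := by
  obtain ⟨K, hK⟩ : ∃ K, T x ∉ S.base K := by simpa using hx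
  have hT : (T ^ ((1 : ℕ) : ℤ)) x = T x := Homeomorph.zpow_natCast_apply 1 x
  have hsucc : ∀ m : ℕ, (T ^ (m : ℤ)) (T x) = (T ^ ((m + 1 : ℕ) : ℤ)) x := fun m => by
    rw [← hT, Homeomorph.zpow_apply_zpow_apply (c := ((m + 1 : ℕ) : ℤ)) (by omega)]
  have hno : NoReturn T (S.base K) x 1 := by
    intro n h0 hn
    obtain rfl : n = 1 := by omega
    rwa [hT]
  have hlt := S.precedes_path_zpow one_pos hno
  rw [hT] at hlt
  refine ⟨hlt, fun r ⟨hxr, hrT⟩ => ?_⟩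
  obtain ⟨y, rfl⟩ := S.path_surjective r
  obtain ⟨n, L, hn, hno', hy⟩ := S.exists_zpow_of_precedes hxr
  obtain ⟨m, rfl⟩ : ∃ m, n = m + 1 := ⟨n - 1, by omega⟩
  rw [← hsucc] at hy
  rcases Nat.eq_zero_or_pos m with rfl | hpos
  · have hy' : y = T x := hy.trans (Homeomorph.zpow_natCast_apply 0 (T x))
    exact OrderedBratteliDiagram.Precedes.irrefl _ (hy' ▸ hrT)
  · have hTr := S.precedes_path_zpow (K := L) (x := T x) hpos fun l hl0 hl => by
      rw [hsucc]
      exact hno' (l + 1) (by omega) (by omega)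
    rw [← hy] at hTr
    exact OrderedBratteliDiagram.Precedes.irrefl _ (hrT.trans hTr)

theorem not_isMaximal_path_iff {x : X} :
    ¬ S.diagram.IsMaximal (S.path x) ↔ T x ∉ ⋂ k, S.base k := by
  refine ⟨fun h => ?_, fun h => not_not.mpr ⟨_, S.isSuccessor_path h⟩⟩
  obtain ⟨q, hq, -⟩ := not_not.mp h
  obtain ⟨y, rfl⟩ := S.path_surjective q
  obtain ⟨n, K, hn, hno, -⟩ := S.exists_zpow_of_precedes hq
  refine fun hmem => hno 1 one_pos hn ?_
  rw [Homeomorph.zpow_natCast_apply]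
  exact mem_iInter.mp hmem K

/-- A homeomorphism of the path space prolongs the Vershik map if and only if it corresponds to `T`
at all points that `T` does not send into the intersection of the base sets. -/
theorem prolongs_iff (R : S.diagram.PathSpace ≃ₜ S.diagram.PathSpace) :
    S.diagram.Prolongs R ↔ ∀ x, T x ∉ ⋂ k, S.base k → R (S.path x) = S.path (T x) := by
  constructor
  · intro h x hx
    rw [h ⟨S.path x, S.not_isMaximal_path_iff.mpr hx⟩]
    exact (OrderedBratteliDiagram.vershikMap_eq_iff _ _).mpr (S.isSuccessor_path hx)
  · rintro h ⟨p, hp⟩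
    obtain ⟨x, rfl⟩ := S.path_surjective p
    have hx := S.not_isMaximal_path_iff.mp hp
    rw [h x hx]
    exact ((OrderedBratteliDiagram.vershikMap_eq_iff _ _).mpr (S.isSuccessor_path hx)).symm

end TowerSystem

/-- Two homeomorphisms that agree wherever the first takes values outside a set whose interior has
at most one point are equal: by continuity they can differ at one point only, hence nowhere. -/
theorem Homeomorph.eq_of_eq_of_apply_notMem {X : Type*} [TopologicalSpace X] [T2Space X]
    {T R : X ≃ₜ X} {F : Set X} (hF : (interior F).Subsingleton)
    (h : ∀ x, T x ∉ F → R x = T x) : R = T := by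
  have hdiff : ∀ x, R x ≠ T x → T x ∈ interior F := by
    intro x hx
    have hopen : IsOpen {y | R y ≠ T y} := isOpen_ne_fun R.continuous T.continuous
    refine interior_maximal ?_ (T.isOpenMap _ hopen) ⟨x, hx, rfl⟩
    rintro _ ⟨y, hy, rfl⟩
    exact not_not.mp fun hyF => hy (h y hyF)
  ext x
  by_contra hx
  obtain ⟨z, hz⟩ := R.surjective (T x)
  have hzx : z ≠ x := fun hzx => hx (hzx ▸ hz)
  have hRz : R z = T z := by
    by_contra hne
    exact hzx (T.injective (hF (hdiff z hne) (hdiff x hx)))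
  exact hzx (T.injective (hRz.symm.trans hz))

/-- The diagram of a tower system is decisive as soon as the intersection of the base sets has at
most one interior point. -/
theorem TowerSystem.bratteliVershikizable {X : Type*} [TopologicalSpace X] [CompactSpace X]
    [T2Space X] [Nonempty X] {T : X ≃ₜ X} (S : TowerSystem T)
    (hS : (interior (⋂ k, S.base k)).Subsingleton) : BratteliVershikizable T := by
  set h := S.pathHomeomorph
  have hpro : S.diagram.Prolongs ((h.symm.trans T).trans h) := by
    refine (S.prolongs_iff _).mpr fun x _ => ?_
    rw [← S.pathHomeomorph_apply, ← S.pathHomeomorph_apply]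
    simp [h]
  refine ⟨S.diagram, ⟨_, hpro, fun R hR => ?_⟩, _, hpro, h, fun x => by simp⟩
  have hRT : (h.trans R).trans h.symm = T :=
    Homeomorph.eq_of_eq_of_apply_notMem hS fun x hx => by
      have := (S.prolongs_iff R).mp hR x hx
      rw [← S.pathHomeomorph_apply, ← S.pathHomeomorph_apply] at this
      rw [Homeomorph.trans_apply, Homeomorph.trans_apply, Homeomorph.symm_apply_eq]
      exact this
  ext p
  have := congrArg (fun R' : X ≃ₜ X => h (R' (h.symm p))) hRT
  simpa using this

end Diagram

end

theorem theorem3p1 {X : Type*} [TopologicalSpace X] [CompactSpace X]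
    [TopologicalSpace.MetrizableSpace X] [TotallyDisconnectedSpace X] [Nonempty X] (T : X ≃ₜ X) :
    BratteliVershikizable T ↔
      Dense (aperiodicPts T) ∨
        ∃! O : Set X, IsPeriodicOrbit T O ∧ Disjoint O (closure (aperiodicPts T)) := by
  refine ⟨fun h => h.dense_or_existsUnique, fun h => ?_⟩
  obtain ⟨B, h0, hanti, hclopen, hhit, hint⟩ := exists_antitone_base_subsingleton h
  obtain ⟨S, rfl⟩ := exists_towerSystem h0 hanti hclopen hhit
  exact S.bratteliVershikizable hint
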